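/- An arena is a countable directed graph in which every vertex has an outgoing edge, with the vertices partitioned into those controlled by Eve and those controlled by Adam. Let $c$ be a coloring of the vertices by $\{0,\dots,d\}$. For an infinite play $\pi=\pi_0\pi_1\cdots$ and a position $k$, let $$\mathrm{dist}_k(\pi,c)=\inf\{k'-k \mid k'\ge k,\ c(\pi_{k'})\text{ is even and } c(\pi_{k'})\le c(\pi_k)\}\in\mathbb N\cup\{\infty\}.$$ In the bounded parity game, Eve wins $\pi$ if and only if $\sup_k \mathrm{dist}_k(\pi,c)<\infty$. Her winning set is the set of vertices from which she has a winning strategy. A strategy with $n$ memory states is given by a set $M$ of $n$ memory states with an initial state, an update function that maps a memory state and a traversed edge to the next memory state, and a next-move function that depends only on the current vertex and the current memory state; it is positional if $n=1$. 1. In every bounded parity game, Eve has a single strategy with $\ell+1$ memory states that is winning from every vertex of her winning set, where $\ell$ is the number of odd colors in $\{0,\dots,d\}$. 2. In general Eve needs at least two memory states, that is, positional strategies do not suffice: there are a bounded parity game and a vertex $v_0$ of Eve's winning set such that no positional strategy of Eve is winning from $v_0$ (hence none is winning from her winning set). -/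

import Mathlib

namespace BoundedParityGames

/-- An arena on a vertex set `V`: a directed graph without dead ends whose vertices are
partitioned into the vertices of Eve (`eve`) and those of Adam (the complement of `eve`). -/
structure Arena (V : Type*) where
  eve : Set V
  edge : V → V → Prop
  exists_edge : ∀ v, ∃ v', edge v v'

/-- A strategy for the player who controls the vertices in `S`: `next w v` is the move prescribed
at the current vertex `v` after the history `w` (the previously visited vertices in chronological
order). Only the values at `v ∈ S` are ever used. -/
structure Strategy {V : Type*} (A : Arena V) (S : Set V) where
  next : List V → V → V
  legal : ∀ w, ∀ v ∈ S, A.edge v (next w v)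

abbrev EveStrategy {V : Type*} (A : Arena V) := Strategy A A.eve

abbrev AdamStrategy {V : Type*} (A : Arena V) := Strategy A A.eveᶜ

open Classical in
/-- The history and the current vertex after `n` steps of the play from `v₀` in which Eve follows
`σ` and Adam follows `τ`. -/
noncomputable def playState {V : Type*} {A : Arena V} (σ : EveStrategy A) (τ : AdamStrategy A)
    (v₀ : V) : ℕ → List V × V
  | 0 => ([], v₀)
  | n + 1 =>
    let w := (playState σ τ v₀ n).1
    let v := (playState σ τ v₀ n).2
    (w ++ [v], if v ∈ A.eve then σ.next w v else τ.next w v)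

/-- The unique play from `v₀` in which Eve follows `σ` and Adam follows `τ`. -/
noncomputable def play {V : Type*} {A : Arena V} (σ : EveStrategy A) (τ : AdamStrategy A)
    (v₀ : V) (n : ℕ) : V :=
  (playState σ τ v₀ n).2

/-- `σ` is winning for Eve for the condition `Ω` from the set `U` of initial vertices. -/
def WinsFrom {V : Type*} {A : Arena V} (σ : EveStrategy A) (Ω : Set (ℕ → V)) (U : Set V) : Prop :=
  ∀ v₀ ∈ U, ∀ τ : AdamStrategy A, play σ τ v₀ ∈ Ω

/-- The winning set of Eve. -/
def winningSet {V : Type*} (A : Arena V) (Ω : Set (ℕ → V)) : Set V :=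
  {v₀ | ∃ σ : EveStrategy A, WinsFrom σ Ω {v₀}}

/-- A memory structure with set of memory states `M`. Only the values of `update m u v` at
edges `(u, v)` of the arena matter. -/
structure MemoryStructure (V M : Type*) where
  init : M
  update : M → V → V → M

/-- The memory state reached from `m` after reading the edges of a finite path. -/
def MemoryStructure.run {V M : Type*} (𝓜 : MemoryStructure V M) : M → List V → M
  | m, u :: v :: w => 𝓜.run (𝓜.update m u v) (v :: w)
  | m, _ => m

/-- `σ` relies on the memory structure `𝓜`: its moves are given by a next-move function of the
current vertex and the current memory state. -/
def UsesMemory {V M : Type*} {A : Arena V} (σ : EveStrategy A) (𝓜 : MemoryStructure V M) : Prop :=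
  ∃ ν : V → M → V, ∀ w, ∀ v ∈ A.eve, σ.next w v = ν v (𝓜.run 𝓜.init (w ++ [v]))

/-- `σ` is a strategy with `k` memory states. -/
def UsesMemoryStates {V : Type*} {A : Arena V} (σ : EveStrategy A) (k : ℕ) : Prop :=
  ∃ 𝓜 : MemoryStructure V (Fin k), UsesMemory σ 𝓜

/-- `σ` is positional (memoryless): it relies on a memory structure with a single state. -/
def IsPositional {V : Type*} {A : Arena V} (σ : EveStrategy A) : Prop :=
  UsesMemoryStates σ 1

/-- The waiting time at position `k` of `π`: the number of steps until the next even color that is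
at most the color at position `k` (`⊤` if there is none). -/
noncomputable def waitingTime {V : Type*} {d : ℕ} (c : V → Fin (d + 1)) (π : ℕ → V) (k : ℕ) : ℕ∞ :=
  ⨅ k' ∈ {k' : ℕ | k ≤ k' ∧ Even (c (π k') : ℕ) ∧ c (π k') ≤ c (π k)}, ((k' - k : ℕ) : ℕ∞)

/-- The bounded parity condition: the waiting times are bounded from the start of the play. -/
def BndParity {V : Type*} {d : ℕ} (c : V → Fin (d + 1)) : Set (ℕ → V) :=
  {π | (⨆ k, waitingTime c π k) < ⊤}

/-- The number of odd colors in the color set `{0, …, d}`. -/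
def numOddColors (d : ℕ) : ℕ :=
  (Finset.univ.filter fun i : Fin (d + 1) => Odd (i : ℕ)).card

end BoundedParityGames

namespace BoundedParityGames

/-! Eve only needs to remember the least odd color still unanswered, or that there is none: `Pending
d`, with one state per odd color plus one. In the product of the arena with this memory, the bounded
parity condition becomes "the gaps between moments with nothing pending are bounded"
(`mem_bndParity_iff_boundedGaps`), a bounded Büchi condition. It remains to show that bounded Büchi
games are positional, uniformly on the winning set.

Let Z be the union of all sets on which some positional strategy wins; a well-ordering of these
strategies gives one that wins on all of Z. Suppose an arbitrary winning strategy starts outside Z.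
If for some N its plays avoiding Z always reached F within N steps, ranking positions by the best
such delay would give a positional win, putting the start in Z. So from each node outside Z, and for
each N, the strategy admits a play that stays N steps outside F and ends outside Z. Concatenating
such segments for growing N gives a losing play, a contradiction.

For the lower bound, Eve must take a detour of unbounded but finite length exactly once: never
taking it leaves a request open, and taking it always lets Adam lengthen it each time. -/

/-- The gaps between visits of `π` to `F` are bounded. -/
def BoundedGaps {B : Type*} (F : Set B) (π : ℕ → B) : Prop :=
  ∃ N, ∀ k, ∃ j ≤ N, π (k + j) ∈ F

/-- `π` is a path in which the moves from `eve` are prescribed by `s`. -/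
def Follows {B : Type*} (E : B → B → Prop) (eve : Set B) (s : B → B) (π : ℕ → B) : Prop :=
  ∀ n, E (π n) (π (n + 1)) ∧ (π n ∈ eve → π (n + 1) = s (π n))

/-- From `X` the positional strategy `s` stays in `X` and keeps the gaps between visits to `F`
bounded. -/
structure Winnable {B : Type*} (E : B → B → Prop) (eve F : Set B) (X : Set B) (s : B → B) :
    Prop where
  edge : ∀ x ∈ X, x ∈ eve → E x (s x)
  eve_mem : ∀ x ∈ X, x ∈ eve → s x ∈ X
  adam_mem : ∀ x ∈ X, x ∉ eve → ∀ y, E x y → y ∈ X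
  wins : ∀ π, π 0 ∈ X → Follows E eve s π → BoundedGaps F π

/-- The union of all sets from which a positional strategy wins. -/
def winnableUnion {B : Type*} (E : B → B → Prop) (eve F : Set B) : Set B :=
  {x | ∃ X s, Winnable E eve F X s ∧ x ∈ X}

/-- `S` is the successor relation of a (history dependent) strategy tree with states `H`, where
`p h` is the position of the game at the state `h`. -/
structure IsStrategyTree {B H : Type*} (E : B → B → Prop) (eve : Set B) (p : H → B)
    (S : H → H → Prop) : Prop where
  edge : ∀ h h', S h h' → E (p h) (p h')
  exists_succ : ∀ h, p h ∈ eve → ∃ h', S h h'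
  adam : ∀ h, p h ∉ eve → ∀ y, E (p h) y → ∃ h', S h h' ∧ p h' = y

/-! ### Positional strategies in bounded Büchi games -/

section Buchi

variable {B : Type*} {E : B → B → Prop} {eve F : Set B}

theorem BoundedGaps.of_shift {π : ℕ → B} {n : ℕ} (h : BoundedGaps F fun k => π (k + n)) :
    BoundedGaps F π := by
  obtain ⟨N, hN⟩ := h
  refine ⟨N + n, fun k => ?_⟩
  obtain ⟨j, hj, hF⟩ := hN k
  exact ⟨j + n, by omega, by simpa [add_assoc] using hF⟩

theorem Follows.shift {s : B → B} {π : ℕ → B} (h : Follows E eve s π) (n : ℕ) :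
    Follows E eve s fun k => π (k + n) := by
  intro k
  have := h (k + n)
  rwa [show k + n + 1 = k + 1 + n by omega] at this

theorem Winnable.succ_mem {X : Set B} {s : B → B} (h : Winnable E eve F X s) {x y : B}
    (hx : x ∈ X) (hE : E x y) (hs : x ∈ eve → y = s x) : y ∈ X := by
  by_cases he : x ∈ eve
  · exact hs he ▸ h.eve_mem x hx he
  · exact h.adam_mem x hx he y hE

/-- The union of all positionally winnable sets is positionally winnable. -/
theorem exists_winnable_winnableUnion (E : B → B → Prop) (eve F : Set B) :
    ∃ s, Winnable E eve F (winnableUnion E eve F) s := by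
  classical
  let I := {i : Set B × (B → B) // Winnable E eve F i.1 i.2}
  -- Well-order the winning pairs and at each position play the strategy of the least pair whose set
  -- contains it.
  obtain ⟨_, _⟩ := exists_wellFoundedLT I
  have hne : ∀ x : winnableUnion E eve F, {i : I | (x : B) ∈ i.1.1}.Nonempty := by
    rintro ⟨x, X, s, hw, hx⟩
    exact ⟨⟨(X, s), hw⟩, hx⟩
  let idx : winnableUnion E eve F → I := fun x => wellFounded_lt.min _ (hne x)
  have hidx : ∀ x : winnableUnion E eve F, (x : B) ∈ (idx x).1.1 := fun x => wellFounded_lt.min_mem _ (hne x)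
  have hmin : ∀ (x : winnableUnion E eve F) (i : I), (x : B) ∈ i.1.1 → idx x ≤ i := fun x i hi =>
    not_lt.1 (wellFounded_lt.not_lt_min {i : I | (x : B) ∈ i.1.1} hi)
  let s : B → B := fun x => if hx : x ∈ winnableUnion E eve F then (idx ⟨x, hx⟩).1.2 x else x
  have hs : ∀ x (hx : x ∈ winnableUnion E eve F), s x = (idx ⟨x, hx⟩).1.2 x := fun x hx =>
    dif_pos hx
  have hU : ∀ (i : I) x, x ∈ i.1.1 → x ∈ winnableUnion E eve F := fun i x hx =>
    ⟨i.1.1, i.1.2, i.2, hx⟩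
  have hsucc : ∀ x (hx : x ∈ winnableUnion E eve F) y, E x y → (x ∈ eve → y = s x) →
      y ∈ (idx ⟨x, hx⟩).1.1 := fun x hx y hE he =>
    (idx ⟨x, hx⟩).2.succ_mem (hidx ⟨x, hx⟩) hE fun h => (he h).trans (hs x hx)
  have hedge : ∀ x ∈ winnableUnion E eve F, x ∈ eve → E x (s x) := fun x hx he => by
    rw [hs x hx]
    exact (idx ⟨x, hx⟩).2.edge x (hidx ⟨x, hx⟩) he
  refine ⟨s, hedge, fun x hx he => hU _ _ (hsucc x hx _ (hedge x hx he) fun _ => rfl),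
    fun x hx he y hE => hU _ _ (hsucc x hx y hE fun h => absurd h he), fun π h0 hπ => ?_⟩
  have hmem : ∀ n, π n ∈ winnableUnion E eve F := by
    intro n
    induction n with
    | zero => exact h0
    | succ n ih => exact hU _ _ (hsucc _ ih _ (hπ n).1 (hπ n).2)
  -- A move stays inside the current pair's set, so the index never increases. It is eventually
  -- constant, and the tail follows one winning strategy.
  have hanti : Antitone fun n => idx ⟨π n, hmem n⟩ :=
    antitone_nat_of_succ_le fun n => hmin _ _ (hsucc _ (hmem n) _ (hπ n).1 (hπ n).2)
  obtain ⟨i, ⟨n, hn⟩, hi⟩ := wellFounded_lt.has_min (Set.range fun n => idx ⟨π n, hmem n⟩)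
    (Set.range_nonempty _)
  have hconst : ∀ k, idx ⟨π (k + n), hmem (k + n)⟩ = i := fun k =>
    le_antisymm ((hanti (Nat.le_add_left n k)).trans_eq hn) (not_lt.1 (hi _ ⟨k + n, rfl⟩))
  refine BoundedGaps.of_shift (n := n) (i.2.wins _ ?_ fun k => ?_)
  · have := hidx ⟨π (0 + n), hmem (0 + n)⟩
    rwa [hconst] at this
  · have := hπ.shift n k
    refine ⟨this.1, fun he => (this.2 he).trans ?_⟩
    rw [hs _ (hmem (k + n)), hconst]

/-- If from every state in `P` there are finite paths back to `P` with arbitrarily long windows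
outside `G`, then some infinite path has arbitrarily long windows outside `G`. -/
theorem exists_path_of_segments {H : Type*} {S : H → H → Prop} {P G : Set H}
    (hseg : ∀ h ∈ P, ∀ N, ∃ (q : ℕ → H) (l : ℕ), q 0 = h ∧ (∀ i < l, S (q i) (q (i + 1))) ∧
      q l ∈ P ∧ ∃ j, j + N ≤ l ∧ ∀ i ≤ N, q (j + i) ∉ G) {h₀ : H} (h0 : h₀ ∈ P) :
    ∃ π : ℕ → H, π 0 = h₀ ∧ (∀ n, S (π n) (π (n + 1))) ∧
      ∀ N, ∃ k, ∀ i ≤ N, π (k + i) ∉ G := by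
  -- Finite paths from `h₀` ending in `P`, coded as a total function and a length.
  let T := {x : (ℕ → H) × ℕ // x.1 0 = h₀ ∧ x.1 x.2 ∈ P ∧ ∀ i < x.2, S (x.1 i) (x.1 (i + 1))}
  have step : ∀ (n : ℕ) (x : T), ∃ y : T, x.1.2 < y.1.2 ∧ (∀ i ≤ x.1.2, y.1.1 i = x.1.1 i) ∧
      ∃ k, k + n ≤ y.1.2 ∧ ∀ i ≤ n, y.1.1 (k + i) ∉ G := by
    rintro n ⟨⟨g, t⟩, hg0, hgP, hgS⟩
    -- Asking for `n + 1` makes the extension strict even for `n = 0`, so the paths converge to an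
    -- infinite one.
    obtain ⟨q, l, hq0, hqS, hqP, j, hj, hG⟩ := hseg _ hgP (n + 1)
    let g' : ℕ → H := fun i => if i ≤ t then g i else q (i - t)
    have hg'1 : ∀ i ≤ t, g' i = g i := fun i hi => if_pos hi
    have hg'2 : ∀ i, g' (t + i) = q i := by
      intro i
      rcases Nat.eq_zero_or_pos i with rfl | hi
      · simp [g', hq0]
      · simp [g', show ¬ (t + i ≤ t) by omega]
    refine ⟨⟨(g', t + l), by simpa [hg'1] using hg0, by simpa [hg'2] using hqP, ?_⟩,
      by simp only; omega, hg'1, t + j, by simp only; omega, fun i hi => ?_⟩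
    · intro i hi
      simp only at hi ⊢
      rcases lt_or_ge i t with h | h
      · rw [hg'1 i h.le, hg'1 (i + 1) h]
        exact hgS i h
      · obtain ⟨a, rfl⟩ := Nat.exists_eq_add_of_le h
        rw [add_assoc, hg'2, hg'2]
        exact hqS a (by omega)
    · simp only [add_assoc, hg'2]
      exact hG i (by omega)
  choose f hf1 hf2 hf3 using step
  let a : ℕ → T := fun n => Nat.rec ⟨(fun _ => h₀, 0), rfl, h0, by simp⟩ (fun n x => f n x) n
  have ha : ∀ n, a (n + 1) = f n (a n) := fun n => rfl
  have hmono : StrictMono fun n => (a n).1.2 := strictMono_nat_of_lt_succ fun n => by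
    simpa only [ha] using hf1 n (a n)
  have hle : ∀ n, n ≤ (a n).1.2 := fun n => hmono.le_apply
  have hagree : ∀ n m i, i ≤ (a n).1.2 → (a (n + m)).1.1 i = (a n).1.1 i := by
    intro n m i hi
    induction m with
    | zero => rfl
    | succ m ih =>
      rw [← add_assoc, ha, hf2 _ _ i (hi.trans (hmono.monotone (Nat.le_add_right n m))), ih]
  have hπ : ∀ n i, i ≤ (a n).1.2 → (a i).1.1 i = (a n).1.1 i := by
    intro n i hi
    rcases le_total n i with h | h
    · obtain ⟨m, rfl⟩ := Nat.exists_eq_add_of_le h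
      exact hagree n m _ hi
    · obtain ⟨m, rfl⟩ := Nat.exists_eq_add_of_le h
      exact (hagree i m i (hle i)).symm
  refine ⟨fun i => (a i).1.1 i, (a 0).2.1, fun n => ?_, fun N => ?_⟩
  · have h1 := hle (n + 1)
    simp only [hπ (n + 1) n (by omega)]
    exact (a (n + 1)).2.2.2 n (by omega)
  · obtain ⟨k, hk, hG⟩ := hf3 N (a N)
    refine ⟨k, fun i hi => ?_⟩
    rw [← ha] at hk hG
    simp only [hπ (N + 1) (k + i) (by omega)]
    exact hG i hi

/-- Every path of the strategy tree that starts in `h` and avoids `Z` visits `F` within `k`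
steps. -/
def ForcedWithin {H : Type*} (p : H → B) (S : H → H → Prop) (F Z : Set B) : ℕ → H → Prop
  | 0, h => p h ∈ F
  | k + 1, h => p h ∈ F ∨ ∀ h', S h h' → p h' ∉ Z → ForcedWithin p S F Z k h'

theorem exists_segment_of_not_forcedWithin {H : Type*} {p : H → B} {S : H → H → Prop}
    {F Z : Set B} {N : ℕ} {h : H} (hZ : p h ∉ Z) (hN : ¬ ForcedWithin p S F Z N h) :
    ∃ q : ℕ → H, q 0 = h ∧ (∀ i < N, S (q i) (q (i + 1))) ∧ p (q N) ∉ Z ∧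
      ∀ i ≤ N, p (q i) ∉ F := by
  induction N generalizing h with
  | zero => exact ⟨fun _ => h, rfl, by simp, hZ, fun _ _ => hN⟩
  | succ N ih =>
    simp only [ForcedWithin, not_or, not_forall] at hN
    obtain ⟨hF, h', hS, hZ', hN'⟩ := hN
    obtain ⟨q, hq0, hqS, hqZ, hqF⟩ := ih hZ' hN'
    refine ⟨fun i => Nat.casesOn i h q, rfl, ?_, hqZ, ?_⟩
    · rintro (_ | i) hi
      · simpa [hq0] using hS
      · exact hqS i (by omega)
    · rintro (_ | i) hi
      · exact hF
      · exact hqF i (by omega)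

theorem exists_segment_of_reflTransGen {H : Type*} {S : H → H → Prop} {h h' : H}
    (hr : Relation.ReflTransGen S h h') :
    ∃ (q : ℕ → H) (l : ℕ), q 0 = h ∧ q l = h' ∧ ∀ i < l, S (q i) (q (i + 1)) := by
  induction hr using Relation.ReflTransGen.head_induction_on with
  | refl => exact ⟨fun _ => h', 0, rfl, rfl, by simp⟩
  | @head a _ hS _ ih =>
    obtain ⟨q, l, hq0, hql, hqS⟩ := ih
    refine ⟨fun i => Nat.casesOn i a q, l + 1, rfl, hql, ?_⟩
    rintro (_ | i) hi
    · simpa [hq0] using hS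
    · exact hqS i (by omega)

/-- A strategy tree all of whose paths outside `winnableUnion` visit `F` with gaps at most `N`
has its root in `winnableUnion`. -/
theorem mem_winnableUnion_of_forcedWithin {H : Type*} {p : H → B} {S : H → H → Prop}
    (hT : IsStrategyTree E eve p S) {h : H} {N : ℕ}
    (hN : ∀ h', Relation.ReflTransGen (fun a b => S a b ∧ p b ∉ winnableUnion E eve F) h h' →
      ForcedWithin p S F (winnableUnion E eve F) N h') : p h ∈ winnableUnion E eve F := by
  classical
  set Z := winnableUnion E eve F with hZdef
  obtain ⟨sZ, hsZ⟩ := exists_winnable_winnableUnion E eve F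
  rw [← hZdef] at hsZ
  let R : Set H := {h' | Relation.ReflTransGen (fun a b => S a b ∧ p b ∉ Z) h h'}
  let C : B → ℕ → Prop := fun x k => ∃ h' ∈ R, p h' = x ∧ ForcedWithin p S F Z k h'
  have hC : ∀ x ∈ p '' R, ∃ k, C x k := by
    rintro _ ⟨h', hR, rfl⟩
    exact ⟨N, h', hR, rfl, hN h' hR⟩
  -- The rank of a position is the best bound over all nodes of `R` at that position. Imitating a
  -- node `g x` that attains it removes the dependence on the history.
  let r : B → ℕ := fun x => sInf {k | C x k}
  have hr : ∀ x ∈ p '' R, C x (r x) := fun x hx => Nat.sInf_mem (hC x hx)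
  have hrle : ∀ x k, C x k → r x ≤ k := fun x k hk => Nat.sInf_le hk
  have hrN : ∀ x ∈ p '' R, r x ≤ N := by
    rintro _ ⟨h', hR, rfl⟩
    exact hrle _ _ ⟨h', hR, rfl, hN h' hR⟩
  have : Nonempty H := ⟨h⟩
  choose! g hgR hgp hgF using hr
  have hnext : ∀ x, ∃ y, x ∈ p '' R → x ∈ eve → ∃ h', S (g x) h' ∧ p h' = y := by
    intro x
    by_cases hx : x ∈ p '' R ∧ x ∈ eve
    · obtain ⟨h', hS⟩ := hT.exists_succ (g x) (by rw [hgp x hx.1]; exact hx.2)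
      exact ⟨p h', fun _ _ => ⟨h', hS, rfl⟩⟩
    · exact ⟨x, fun h1 h2 => absurd ⟨h1, h2⟩ hx⟩
  choose sX hsX using hnext
  let s : B → B := fun x => if x ∈ Z then sZ x else sX x
  have hlift : ∀ x ∈ p '' R, x ∉ Z → ∀ y, E x y → (x ∈ eve → y = s x) →
      ∃ h', S (g x) h' ∧ p h' = y := by
    intro x hx hxZ y hE hs
    by_cases he : x ∈ eve
    · rw [hs he]
      simpa [s, hxZ] using hsX x hx he
    · exact hT.adam (g x) (by rwa [hgp x hx]) y (by rwa [hgp x hx])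
  -- The child of `g x` is forced one step sooner, and the rank of its position is at most that, so
  -- the rank drops outside `F`.
  have hstep : ∀ x ∈ p '' R, x ∉ Z → ∀ y, E x y → (x ∈ eve → y = s x) → y ∉ Z →
      y ∈ p '' R ∧ (x ∉ F → r y < r x) := by
    intro x hx hxZ y hE hs hyZ
    obtain ⟨h', hS, rfl⟩ := hlift x hx hxZ y hE hs
    have hR : h' ∈ R := Relation.ReflTransGen.tail (hgR x hx) ⟨hS, hyZ⟩
    refine ⟨⟨h', hR, rfl⟩, fun hxF => ?_⟩
    have hF := hgF x hx
    generalize r x = k at hF ⊢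
    cases k with
    | zero => exact absurd (hgp x hx ▸ hF) hxF
    | succ k =>
      rcases hF with hF | hF
      · exact absurd (hgp x hx ▸ hF) hxF
      · exact Nat.lt_succ_of_le (hrle _ _ ⟨h', hR, rfl, hF h' hS hyZ⟩)
  have hstep' : ∀ x ∈ Z ∪ p '' R, ∀ y, E x y → (x ∈ eve → y = s x) → y ∈ Z ∪ p '' R := by
    intro x hx y hE hs
    by_cases hxZ : x ∈ Z
    · exact Or.inl (hsZ.succ_mem hxZ hE fun he => by simpa [s, hxZ] using hs he)
    · by_cases hyZ : y ∈ Z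
      · exact Or.inl hyZ
      · exact Or.inr (hstep x (hx.resolve_left hxZ) hxZ y hE hs hyZ).1
  have hedge : ∀ x ∈ Z ∪ p '' R, x ∈ eve → E x (s x) := by
    intro x hx he
    by_cases hxZ : x ∈ Z
    · simpa [s, hxZ] using hsZ.edge x hxZ he
    · have hx' := hx.resolve_left hxZ
      obtain ⟨h', hS, hp⟩ := hsX x hx' he
      simpa [s, hxZ, hp, hgp x hx'] using hT.edge _ _ hS
  refine ⟨Z ∪ p '' R, s, ⟨hedge, fun x hx he => hstep' x hx _ (hedge x hx he) fun _ => rfl,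
    fun x hx he y hE => hstep' x hx y hE fun h => absurd h he, fun π h0 hπ => ?_⟩,
    Or.inr ⟨h, Relation.ReflTransGen.refl, rfl⟩⟩
  -- Once in `Z` the play follows `sZ` forever. Otherwise ranks, which never exceed `N`, count down
  -- to the next visit of `F`.
  by_cases hZ : ∃ n, π n ∈ Z
  · obtain ⟨n, hn⟩ := hZ
    have hmem : ∀ k, π (k + n) ∈ Z := by
      intro k
      induction k with
      | zero => simpa using hn
      | succ k ih =>
        have := hπ.shift n k
        exact hsZ.succ_mem ih this.1 fun he => by simpa [s, ih] using this.2 he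
    refine BoundedGaps.of_shift (n := n) (hsZ.wins _ (hmem 0) fun k => ?_)
    have := hπ.shift n k
    exact ⟨this.1, fun he => by simpa [s, hmem k] using this.2 he⟩
  · push Not at hZ
    have hmem : ∀ n, π n ∈ p '' R := by
      intro n
      induction n with
      | zero => exact h0.resolve_left (hZ 0)
      | succ n ih => exact (hstep _ ih (hZ n) _ (hπ n).1 (hπ n).2 (hZ (n + 1))).1
    have key : ∀ m k, r (π k) ≤ m → ∃ j ≤ m, π (k + j) ∈ F := by
      intro m
      induction m with
      | zero =>
        intro k hk
        refine ⟨0, le_rfl, ?_⟩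
        by_contra hF
        exact absurd ((hstep _ (hmem k) (hZ k) _ (hπ k).1 (hπ k).2 (hZ (k + 1))).2 hF) (by omega)
      | succ m ih =>
        intro k hk
        by_cases hF : π k ∈ F
        · exact ⟨0, by omega, hF⟩
        · have := (hstep _ (hmem k) (hZ k) _ (hπ k).1 (hπ k).2 (hZ (k + 1))).2 hF
          obtain ⟨j, hj, hjF⟩ := ih (k + 1) (by omega)
          exact ⟨j + 1, by omega, by rwa [show k + (j + 1) = k + 1 + j by omega]⟩
    exact ⟨N, fun k => key N k (hrN _ (hmem k))⟩

/-- If all paths of a strategy tree from `h₀` visit `F` with bounded gaps, then a positional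
strategy wins from the position of `h₀`. -/
theorem mem_winnableUnion_of_tree {H : Type*} {p : H → B} {S : H → H → Prop}
    (hT : IsStrategyTree E eve p S) {h₀ : H}
    (hwin : ∀ π : ℕ → H, π 0 = h₀ → (∀ n, S (π n) (π (n + 1))) → BoundedGaps F fun n => p (π n)) :
    p h₀ ∈ winnableUnion E eve F := by
  by_contra h0
  obtain ⟨π, hπ0, hπS, hπ⟩ := exists_path_of_segments (S := S)
    (P := {h | p h ∉ winnableUnion E eve F}) (G := {h | p h ∈ F}) (by
      intro h hh N
      -- Some node reachable outside the union is not forced within `N`; the segment is the path to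
      -- it followed by a path witnessing this failure.
      have hN := mt (mem_winnableUnion_of_forcedWithin (N := N) (h := h) (F := F) hT) hh
      simp only [not_forall] at hN
      obtain ⟨h', hr, hn⟩ := hN
      have hh' : p h' ∉ winnableUnion E eve F := by
        cases hr with
        | refl => exact hh
        | tail _ h => exact h.2
      obtain ⟨q₁, l, h10, h1l, h1S⟩ := exists_segment_of_reflTransGen hr
      obtain ⟨q₂, h20, h2S, h2Z, h2F⟩ := exists_segment_of_not_forcedWithin hh' hn
      have e1 : ∀ i ≤ l, (fun i => if i ≤ l then q₁ i else q₂ (i - l)) i = q₁ i :=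
        fun i hi => if_pos hi
      have e2 : ∀ i, (fun i => if i ≤ l then q₁ i else q₂ (i - l)) (l + i) = q₂ i := by
        intro i
        rcases Nat.eq_zero_or_pos i with rfl | hi
        · simp [h1l, h20]
        · simp [show ¬ (l + i ≤ l) by omega]
      generalize (fun i => if i ≤ l then q₁ i else q₂ (i - l)) = q at e1 e2
      refine ⟨q, l + N, by rw [e1 0 (by omega), h10], fun i hi => ?_, by
        simpa only [Set.mem_ofPred_eq, e2] using h2Z, l, le_rfl, fun i hi => by
        simpa only [Set.mem_ofPred_eq, e2] using h2F i hi⟩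
      rcases lt_or_ge i l with h | h
      · rw [e1 i h.le, e1 (i + 1) h]
        exact (h1S i h).1
      · obtain ⟨a, rfl⟩ := Nat.exists_eq_add_of_le h
        rw [add_assoc, e2, e2]
        exact h2S a (by omega)) h0
  obtain ⟨N, hN⟩ := hwin π hπ0 hπS
  obtain ⟨k, hk⟩ := hπ N
  obtain ⟨j, hj, hF⟩ := hN k
  exact hk j hj hF

end Buchi

end BoundedParityGames

namespace BoundedParityGames

/-! ### Plays consistent with a strategy of Eve -/

section Plays

variable {V : Type*} {A : Arena V}

/-- `π` is a play from `v₀` in which Eve follows `σ`. -/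
def Consistent (σ : EveStrategy A) (v₀ : V) (π : ℕ → V) : Prop :=
  π 0 = v₀ ∧ ∀ n, A.edge (π n) (π (n + 1)) ∧
    (π n ∈ A.eve → π (n + 1) = σ.next ((List.range n).map π) (π n))

theorem playState_fst (σ : EveStrategy A) (τ : AdamStrategy A) (v₀ : V) (n : ℕ) :
    (playState σ τ v₀ n).1 = (List.range n).map (play σ τ v₀) := by
  induction n with
  | zero => rfl
  | succ n ih => simp [playState, ih, List.range_succ, play]

open Classical in
theorem play_succ (σ : EveStrategy A) (τ : AdamStrategy A) (v₀ : V) (n : ℕ) :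
    play σ τ v₀ (n + 1) = if play σ τ v₀ n ∈ A.eve
      then σ.next ((List.range n).map (play σ τ v₀)) (play σ τ v₀ n)
      else τ.next ((List.range n).map (play σ τ v₀)) (play σ τ v₀ n) := by
  rw [← playState_fst]
  rfl

theorem consistent_play (σ : EveStrategy A) (τ : AdamStrategy A) (v₀ : V) :
    Consistent σ v₀ (play σ τ v₀) := by
  refine ⟨rfl, fun n => ?_⟩
  rw [play_succ]
  split_ifs with h
  · exact ⟨σ.legal _ _ h, fun _ => rfl⟩
  · exact ⟨τ.legal _ _ h, fun h' => absurd h' h⟩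

/-- Adam replays `π`, using the length of the history as a clock, with an arbitrary legal move
wherever `π` prescribes none. -/
theorem Consistent.exists_play_eq {σ : EveStrategy A} {v₀ : V} {π : ℕ → V}
    (hπ : Consistent σ v₀ π) : ∃ τ : AdamStrategy A, play σ τ v₀ = π := by
  classical
  let τ : AdamStrategy A :=
    { next := fun w v => if A.edge v (π (w.length + 1)) then π (w.length + 1)
        else (A.exists_edge v).choose
      legal := fun w v _ => by
        split_ifs with h
        · exact h
        · exact (A.exists_edge v).choose_spec }
  have key : ∀ n, ∀ m ≤ n, play σ τ v₀ m = π m := by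
    intro n
    induction n with
    | zero =>
      intro m hm
      obtain rfl : m = 0 := by omega
      exact hπ.1.symm
    | succ n ih =>
      intro m hm
      rcases Nat.lt_or_ge m (n + 1) with h | h
      · exact ih m (by omega)
      obtain rfl : m = n + 1 := by omega
      have hw : (List.range n).map (play σ τ v₀) = (List.range n).map π :=
        List.map_congr_left fun i hi => ih i (List.mem_range.1 hi).le
      rw [play_succ, hw, ih n le_rfl]
      split_ifs with he
      · exact ((hπ.2 n).2 he).symm
      · simp [τ, (hπ.2 n).1]
  exact ⟨τ, funext fun n => key n n le_rfl⟩

theorem winsFrom_iff {σ : EveStrategy A} {Ω : Set (ℕ → V)} {U : Set V} :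
    WinsFrom σ Ω U ↔ ∀ v₀ ∈ U, ∀ π, Consistent σ v₀ π → π ∈ Ω := by
  refine ⟨fun h v₀ hv π hπ => ?_, fun h v₀ hv τ => h v₀ hv _ (consistent_play σ τ v₀)⟩
  obtain ⟨τ, rfl⟩ := hπ.exists_play_eq
  exact h v₀ hv τ

end Plays

/-! ### Reduction of bounded parity to bounded Büchi -/

section Parity

variable {V : Type*} {d : ℕ}

theorem mem_bndParity_iff {c : V → Fin (d + 1)} {π : ℕ → V} :
    π ∈ BndParity c ↔
      ∃ N : ℕ, ∀ k, ∃ j ≤ N, Even (c (π (k + j)) : ℕ) ∧ c (π (k + j)) ≤ c (π k) := by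
  constructor
  · intro h
    obtain ⟨N, hN⟩ := ENat.ne_top_iff_exists.1 (ne_of_lt (show _ < ⊤ from h))
    refine ⟨N, fun k => ?_⟩
    -- The strict bound `N + 1` lets `iInf_lt_iff` produce a witness.
    have hk : waitingTime c π k < ((N + 1 : ℕ) : ℕ∞) :=
      lt_of_le_of_lt ((le_iSup _ k).trans_eq hN.symm) (by exact_mod_cast Nat.lt_succ_self N)
    simp only [waitingTime, iInf_lt_iff] at hk
    obtain ⟨k', ⟨hk', he, hc⟩, hlt⟩ := hk
    have hlt' : k' - k < N + 1 := by exact_mod_cast hlt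
    refine ⟨k' - k, by omega, ?_⟩
    rw [show k + (k' - k) = k' by omega]
    exact ⟨he, hc⟩
  · rintro ⟨N, hN⟩
    refine lt_of_le_of_lt (iSup_le fun k => ?_) (ENat.natCast_lt_top N)
    obtain ⟨j, hj, he, hc⟩ := hN k
    refine (iInf₂_le (k + j) ⟨by omega, he, hc⟩).trans ?_
    exact_mod_cast (by omega : k + j - k ≤ N)

/-- The least pending odd color, if any. -/
abbrev Pending (d : ℕ) := Option {i : Fin (d + 1) // Odd (i : ℕ)}

/-- The least pending odd color after reading a further color. -/
def readColor : Pending d → Fin (d + 1) → Pending d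
  | none, p => if h : Odd (p : ℕ) then some ⟨p, h⟩ else none
  | some q, p =>
    if h : Odd (p : ℕ) then (if p < q.1 then some ⟨p, h⟩ else some q)
    else if p ≤ q.1 then none else some q

theorem card_pending (d : ℕ) : Fintype.card (Pending d) = numOddColors d + 1 := by
  rw [Fintype.card_option, Fintype.card_subtype, numOddColors]

/-- The least pending odd color before position `k`. -/
def pendingBefore (e : ℕ → Fin (d + 1)) : ℕ → Pending d
  | 0 => none
  | k + 1 => readColor (pendingBefore e k) (e k)

/-- As long as the color at `k` is unanswered, some odd color at most `e k` remains pending, so an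
empty memory certifies an answer. -/
theorem bounded_of_pending {e : ℕ → Fin (d + 1)} {N : ℕ}
    (h : ∀ k, ∃ j ≤ N, pendingBefore e (k + j + 1) = none) (k : ℕ) :
    ∃ j ≤ N, Even (e (k + j) : ℕ) ∧ e (k + j) ≤ e k := by
  by_contra! hcon
  have key : ∀ j ≤ N, ∃ q, pendingBefore e (k + j + 1) = some q ∧ q.1 ≤ e k := by
    intro j
    induction j with
    | zero =>
      intro _
      have h0 : Odd (e k : ℕ) := by
        by_contra ho
        exact absurd (hcon 0 (by omega) (Nat.not_odd_iff_even.1 ho)) (by simp)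
      simp only [pendingBefore]
      cases pendingBefore e k with
      | none => exact ⟨⟨e k, h0⟩, by simp [readColor, h0], le_rfl⟩
      | some q =>
        by_cases hq : e k < q.1
        · exact ⟨⟨e k, h0⟩, by simp [readColor, h0, hq], le_rfl⟩
        · exact ⟨q, by simp [readColor, h0, hq], not_lt.1 hq⟩
    | succ j ih =>
      intro hj
      obtain ⟨q, hq, hle⟩ := ih (by omega)
      rw [show k + (j + 1) + 1 = (k + j + 1) + 1 by omega, pendingBefore, hq]
      have hc := hcon (j + 1) hj
      rw [show k + (j + 1) = k + j + 1 by omega] at hc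
      by_cases ho : Odd (e (k + j + 1) : ℕ)
      · by_cases hlt : e (k + j + 1) < q.1
        · exact ⟨⟨_, ho⟩, by simp [readColor, ho, hlt], hlt.le.trans hle⟩
        · exact ⟨q, by simp [readColor, ho, hlt], hle⟩
      · have hlt := hc (Nat.not_odd_iff_even.1 ho)
        exact ⟨q, by simp [readColor, ho, hle.trans_lt hlt], hle⟩
  obtain ⟨j, hj, hn⟩ := h k
  obtain ⟨q, hq, _⟩ := key j hj
  simp [hn] at hq

/-- The pending color was read earlier and is due an answer within `N` steps of that time. An answer
already given would have cleared it, so the answer lies strictly ahead. -/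
theorem answer_of_pending {e : ℕ → Fin (d + 1)} {N : ℕ}
    (h : ∀ k, ∃ j ≤ N, Even (e (k + j) : ℕ) ∧ e (k + j) ≤ e k) (k : ℕ) :
    ∀ q, pendingBefore e (k + 1) = some q →
      ∃ j ≤ N, 0 < j ∧ Even (e (k + j) : ℕ) ∧ e (k + j) ≤ q.1 := by
  have new : ∀ k, Odd (e k : ℕ) → ∃ j ≤ N, 0 < j ∧ Even (e (k + j) : ℕ) ∧ e (k + j) ≤ e k := by
    intro k ho
    obtain ⟨j, hj, he, hle⟩ := h k
    refine ⟨j, hj, Nat.pos_of_ne_zero ?_, he, hle⟩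
    rintro rfl
    exact Nat.not_even_iff_odd.2 ho he
  induction k with
  | zero =>
    intro q hq
    simp only [pendingBefore, readColor] at hq
    split_ifs at hq with ho
    obtain rfl := Option.some.inj hq
    exact new 0 ho
  | succ k ih =>
    intro q hq
    have old : pendingBefore e (k + 1) = some q → ¬ (Even (e (k + 1) : ℕ) ∧ e (k + 1) ≤ q.1) →
        ∃ j ≤ N, 0 < j ∧ Even (e (k + 1 + j) : ℕ) ∧ e (k + 1 + j) ≤ q.1 := by
      intro hq' hne
      obtain ⟨j, hj, hpos, he, hle⟩ := ih q hq'
      obtain ⟨i, rfl⟩ : ∃ i, j = i + 1 := ⟨j - 1, by omega⟩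
      rw [show k + (i + 1) = k + 1 + i by omega] at he hle
      refine ⟨i, by omega, Nat.pos_of_ne_zero ?_, he, hle⟩
      rintro rfl
      exact hne ⟨he, hle⟩
    rw [pendingBefore] at hq
    cases hm : pendingBefore e (k + 1) with
    | none =>
      rw [hm] at hq
      simp only [readColor] at hq
      split_ifs at hq with ho
      obtain rfl := Option.some.inj hq
      exact new _ ho
    | some q' =>
      rw [hm] at hq
      simp only [readColor] at hq
      split_ifs at hq with ho hlt hle
      · obtain rfl := Option.some.inj hq
        exact new _ ho
      · obtain rfl := Option.some.inj hq
        exact old hm fun h' => Nat.not_even_iff_odd.2 ho h'.1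
      · obtain rfl := Option.some.inj hq
        exact old hm fun h' => hle h'.2

theorem pending_le_or_none {e : ℕ → Fin (d + 1)} {k : ℕ} {q}
    (hq : pendingBefore e (k + 1) = some q) (i : ℕ) :
    (∃ i' ≤ i, pendingBefore e (k + i' + 1) = none) ∨
      ∃ q', pendingBefore e (k + i + 1) = some q' ∧ q'.1 ≤ q.1 := by
  induction i with
  | zero => exact Or.inr ⟨q, hq, le_rfl⟩
  | succ i ih =>
    rcases ih with ⟨i', hi', hn⟩ | ⟨q', hq', hle⟩
    · exact Or.inl ⟨i', by omega, hn⟩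
    · cases hm : pendingBefore e (k + (i + 1) + 1) with
      | none => exact Or.inl ⟨i + 1, le_rfl, hm⟩
      | some q'' =>
        refine Or.inr ⟨q'', rfl, ?_⟩
        rw [show k + (i + 1) + 1 = (k + i + 1) + 1 by omega, pendingBefore, hq'] at hm
        simp only [readColor] at hm
        split_ifs at hm with ho hlt
        · obtain rfl := Option.some.inj hm
          exact hlt.le.trans hle
        · obtain rfl := Option.some.inj hm
          exact hle
        · obtain rfl := Option.some.inj hm
          exact hle

/-- When the answer to the pending color arrives, either the memory has been cleared by then or a
smaller color has become pending in the meantime. This can repeat only once per color, each round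
costing at most `N` steps. -/
theorem pending_of_bounded {e : ℕ → Fin (d + 1)} {N : ℕ}
    (h : ∀ k, ∃ j ≤ N, Even (e (k + j) : ℕ) ∧ e (k + j) ≤ e k) (k : ℕ) :
    ∃ j ≤ (d + 1) * N, pendingBefore e (k + j + 1) = none := by
  have key : ∀ n k q, pendingBefore e (k + 1) = some q → (q.1 : ℕ) < n →
      ∃ j ≤ n * N, pendingBefore e (k + j + 1) = none := by
    intro n
    induction n with
    | zero => intro k q _ hn; omega
    | succ n ih =>
      intro k q hq hn
      obtain ⟨j, hj, hpos, he, hle⟩ := answer_of_pending h k q hq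
      obtain ⟨i, rfl⟩ : ∃ i, j = i + 1 := ⟨j - 1, by omega⟩
      have hmul : (n + 1) * N = n * N + N := by ring
      rcases pending_le_or_none hq i with ⟨i', hi', hnone⟩ | ⟨q', hq', hle'⟩
      · exact ⟨i', by omega, hnone⟩
      · have hread : pendingBefore e (k + (i + 1) + 1) =
            if e (k + (i + 1)) ≤ q'.1 then none else some q' := by
          rw [show k + (i + 1) = k + i + 1 by omega] at he ⊢
          rw [pendingBefore, hq']
          simp only [readColor, dif_neg (Nat.not_odd_iff_even.2 he)]
        split_ifs at hread with hc
        · exact ⟨i + 1, by omega, hread⟩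
        · have hlt : (q'.1 : ℕ) < q.1 := (not_le.1 hc).trans_le hle
          obtain ⟨j', hj', hnone⟩ := ih (k + (i + 1)) q' hread (by omega)
          exact ⟨i + 1 + j', by omega, by rwa [← add_assoc]⟩
  cases hm : pendingBefore e (k + 1) with
  | none => exact ⟨0, by omega, hm⟩
  | some q => exact key (d + 1) k q hm q.1.2

/-- The pairs of a vertex and a memory content after which no request is pending. -/
def noPending (c : V → Fin (d + 1)) : Set (V × Pending d) := {x | readColor x.2 (c x.1) = none}

theorem mem_bndParity_iff_boundedGaps {c : V → Fin (d + 1)} {π : ℕ → V} :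
    π ∈ BndParity c ↔
      BoundedGaps (noPending c) fun k => (π k, pendingBefore (fun i => c (π i)) k) := by
  rw [mem_bndParity_iff]
  exact ⟨fun ⟨N, hN⟩ => ⟨_, pending_of_bounded (e := fun i => c (π i)) hN⟩,
    fun ⟨N, hN⟩ => ⟨N, bounded_of_pending (e := fun i => c (π i)) hN⟩⟩

theorem pendingBefore_eq_foldl (c : V → Fin (d + 1)) (π : ℕ → V) (k : ℕ) :
    pendingBefore (fun i => c (π i)) k =
      ((List.range k).map π).foldl (fun m u => readColor m (c u)) none := by
  induction k with
  | zero => rfl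
  | succ k ih => simp [pendingBefore, ih, List.range_succ]

theorem MemoryStructure.run_append_singleton {M : Type*} (𝓜 : MemoryStructure V M)
    (f : M → V → M) (hf : ∀ m u v, 𝓜.update m u v = f m u) (m : M) (w : List V) (v : V) :
    𝓜.run m (w ++ [v]) = w.foldl f m := by
  induction w generalizing m with
  | nil => rfl
  | cons u w ih =>
    cases w with
    | nil => simp [MemoryStructure.run, hf]
    | cons u' w =>
      rw [List.foldl_cons, ← hf m u u', ← ih]
      rfl

/-- Eve wins a bounded parity game on her whole winning set by remembering the least pending odd
color. -/
theorem exists_memory_winsFrom_winningSet (A : Arena V) (c : V → Fin (d + 1)) :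
    ∃ σ : EveStrategy A, UsesMemoryStates σ (numOddColors d + 1) ∧
      WinsFrom σ (BndParity c) (winningSet A (BndParity c)) := by
  classical
  let E : V × Pending d → V × Pending d → Prop := fun x y =>
    A.edge x.1 y.1 ∧ y.2 = readColor x.2 (c x.1)
  let eve : Set (V × Pending d) := {x | x.1 ∈ A.eve}
  obtain ⟨s, hs⟩ := exists_winnable_winnableUnion E eve (noPending c)
  let mem : List V → Pending d := fun w => w.foldl (fun m u => readColor m (c u)) none
  -- Outside the winnable union `s` may be illegal, hence the default move.
  let ν : V → Pending d → V := fun v m =>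
    if A.edge v (s (v, m)).1 then (s (v, m)).1 else (A.exists_edge v).choose
  have hν : ∀ v m, A.edge v (ν v m) := by
    intro v m
    dsimp only [ν]
    split_ifs with h
    · exact h
    · exact (A.exists_edge v).choose_spec
  refine ⟨⟨fun w v => ν v (mem w), fun w v _ => hν v (mem w)⟩, ?_, ?_⟩
  · let φ := Fintype.equivFinOfCardEq (card_pending d)
    let f : Fin (numOddColors d + 1) → V → Fin (numOddColors d + 1) :=
      fun m u => φ (readColor (φ.symm m) (c u))
    refine ⟨⟨φ none, fun m u _ => f m u⟩, fun v m => ν v (φ.symm m), fun w v _ => ?_⟩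
    rw [MemoryStructure.run_append_singleton _ f fun _ _ _ => rfl]
    have hfold : ∀ (w : List V) m, φ.symm (w.foldl f (φ m)) =
        w.foldl (fun m u => readColor m (c u)) m := by
      intro w
      induction w with
      | nil => simp
      | cons u w ih => intro m; simp [f, ih]
    simp only [hfold, mem]
  · rw [winsFrom_iff]
    rintro v₀ ⟨σ, hσ⟩ π hπ
    rw [winsFrom_iff] at hσ
    replace hσ := hσ v₀ rfl
    rw [mem_bndParity_iff_boundedGaps]
    -- The strategy `σ`, which depends on `v₀`, serves only here: its tree of histories puts the
    -- initial position into the union, on which the single `s` wins.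
    have hZ : (v₀, (none : Pending d)) ∈ winnableUnion E eve (noPending c) := by
      let S : List V × V → List V × V → Prop := fun h h' => h'.1 = h.1 ++ [h.2] ∧
        A.edge h.2 h'.2 ∧ (h.2 ∈ A.eve → h'.2 = σ.next h.1 h.2)
      refine mem_winnableUnion_of_tree (p := fun h : List V × V => (h.2, mem h.1)) (S := S)
        (h₀ := ([], v₀)) ⟨?_, ?_, ?_⟩ ?_
      · rintro ⟨w, v⟩ ⟨w', v'⟩ ⟨rfl, hE, -⟩
        exact ⟨hE, by simp [mem]⟩
      · rintro ⟨w, v⟩ he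
        exact ⟨(w ++ [v], σ.next w v), rfl, σ.legal w v he, fun _ => rfl⟩
      · rintro ⟨w, v⟩ he ⟨v', m⟩ ⟨hE, hm⟩
        refine ⟨(w ++ [v], v'), ⟨rfl, hE, fun h => absurd h he⟩, ?_⟩
        simp only at hm
        simp [hm, mem]
      · intro ρ hρ0 hρ
        have hw : ∀ n, (ρ n).1 = (List.range n).map fun i => (ρ i).2 := by
          intro n
          induction n with
          | zero => simp [hρ0]
          | succ n ih => rw [(hρ n).1, ih]; simp [List.range_succ]
        have := hσ (fun n => (ρ n).2) ⟨by simp [hρ0], fun n => ⟨(hρ n).2.1, fun he => by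
          rw [← hw n]; exact (hρ n).2.2 he⟩⟩
        rw [mem_bndParity_iff_boundedGaps] at this
        simpa only [mem, hw, ← pendingBefore_eq_foldl] using this
    set ρ : ℕ → V × Pending d := fun k => (π k, pendingBefore (fun i => c (π i)) k) with hρ
    have hE : ∀ n, E (ρ n) (ρ (n + 1)) := fun n => ⟨(hπ.2 n).1, rfl⟩
    have hmove : ∀ n, ρ n ∈ winnableUnion E eve (noPending c) → ρ n ∈ eve →
        ρ (n + 1) = s (ρ n) := by
      intro n hn he
      have hEs := hs.edge _ hn he
      refine Prod.ext ?_ ((hE n).2.trans hEs.2.symm)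
      have h1 := (hπ.2 n).2 he
      simp only [mem, ← pendingBefore_eq_foldl, ν] at h1
      rw [if_pos hEs.1] at h1
      exact h1
    have hmem : ∀ n, ρ n ∈ winnableUnion E eve (noPending c) := by
      intro n
      induction n with
      | zero => simpa [hρ, hπ.1, pendingBefore] using hZ
      | succ n ih => exact hs.succ_mem ih (hE n) (hmove n ih)
    exact hs.wins ρ (hmem 0) fun n => ⟨hE n, hmove n (hmem n)⟩

end Parity

end BoundedParityGames

/-! ### A game without positional winning strategies -/

namespace BoundedParityGames

/-- From vertex `1` Eve may either stay there or move to the vertex `2` of Adam, who chooses a path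
of arbitrary length back to vertex `1`. -/
def detourArena : Arena ℕ where
  eve := {1}
  edge u v := (u = 0 ∧ v = 1) ∨ (u = 1 ∧ (v = 1 ∨ v = 2)) ∨ (u = 2 ∧ 3 ≤ v) ∨ (u = 3 ∧ v = 1) ∨
    (4 ≤ u ∧ u = v + 1)
  exists_edge u := by
    rcases (by omega : u = 0 ∨ u = 1 ∨ u = 2 ∨ u = 3 ∨ 4 ≤ u) with h | h | h | h | h
    · exact ⟨1, by omega⟩
    · exact ⟨1, by omega⟩
    · exact ⟨3, by omega⟩
    · exact ⟨1, by omega⟩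
    · exact ⟨u - 1, by omega⟩

/-- Vertex `1` is neutral, vertex `3` answers all requests, and all other vertices are requests. -/
def detourColor (v : ℕ) : Fin 3 := if v = 1 then 2 else if v = 3 then 0 else 1

/-- Eve takes the detour once, to answer the request at `0`, and then stays at `1`. The detour is
finite, so the waiting times of each single play are bounded. -/
theorem zero_mem_winningSet_detour : 0 ∈ winningSet detourArena (BndParity detourColor) := by
  classical
  refine ⟨⟨fun w _ => if 3 ∈ w then 1 else 2, fun w v hv => ?_⟩, ?_⟩
  · obtain rfl : v = 1 := hv
    dsimp only [detourArena]
    split_ifs <;> omega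
  rw [winsFrom_iff]
  rintro _ rfl π ⟨h0, hπ⟩
  rw [mem_bndParity_iff]
  have hE : ∀ n, (π n = 0 ∧ π (n + 1) = 1) ∨ (π n = 1 ∧ (π (n + 1) = 1 ∨ π (n + 1) = 2)) ∨
    (π n = 2 ∧ 3 ≤ π (n + 1)) ∨ (π n = 3 ∧ π (n + 1) = 1) ∨
    (4 ≤ π n ∧ π n = π (n + 1) + 1) := fun n => (hπ n).1
  have h1 : π 1 = 1 := by have := hE 0; simp only [zero_add] at this; omega
  have h2 : π 2 = 2 := by
    have := (hπ 1).2 h1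
    simpa [List.range_succ, h0] using this
  have h3 : 3 ≤ π 3 := by have := hE 2; simp only [Nat.reduceAdd] at this; omega
  obtain ⟨n, hn⟩ : ∃ n, π 3 = n + 3 := ⟨π 3 - 3, by omega⟩
  have hdown : ∀ i ≤ n, π (3 + i) = n + 3 - i := by
    intro i
    induction i with
    | zero => intro _; simpa using hn
    | succ i ih =>
      intro hi
      have h := ih (by omega)
      have := hE (3 + i)
      rw [show 3 + (i + 1) = 3 + i + 1 by omega]
      omega
  have hans : π (n + 3) = 3 := by
    have := hdown n le_rfl
    rw [show n + 3 = 3 + n by omega]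
    omega
  have hstay : ∀ k, π (n + 4 + k) = 1 := by
    intro k
    induction k with
    | zero => have := hE (n + 3); rw [show n + 3 + 1 = n + 4 + 0 by omega] at this; omega
    | succ k ih =>
      have := (hπ (n + 4 + k)).2 ih
      have hmem : 3 ∈ (List.range (n + 4 + k)).map π :=
        List.mem_map.2 ⟨n + 3, List.mem_range.2 (by omega), hans⟩
      simpa only [hmem, if_true, ← add_assoc] using this
  refine ⟨n + 3, fun k => ?_⟩
  rcases Nat.lt_or_ge (n + 3) k with hk | hk
  · obtain ⟨i, rfl⟩ := Nat.exists_eq_add_of_le (show n + 4 ≤ k by omega)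
    refine ⟨0, by omega, ?_, le_rfl⟩
    simp [hstay, detourColor]
  · refine ⟨n + 3 - k, by omega, ?_⟩
    rw [show k + (n + 3 - k) = n + 3 by omega, hans]
    simp [detourColor]

/-- The play in which Eve always moves from `1` to `2`, and Adam chooses longer and longer
detours. -/
def detourPlay : ℕ → ℕ
  | 0 => 0
  | k + 1 =>
    match detourPlay k with
    | 0 => 1
    | 1 => 2
    | 2 => k + 4
    | 3 => 1
    | m + 4 => m + 3

/-- A detour begun at time `k` leads to vertex `k + 4`, and at least `k + 1` consecutive vertices of
color `1` follow. Detours begin arbitrarily late. -/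
theorem detourPlay_not_mem : detourPlay ∉ BndParity detourColor := by
  rw [mem_bndParity_iff]
  rintro ⟨N, hN⟩
  have h1 : ∀ k, detourPlay k = 1 → detourPlay (k + 1) = 2 := fun k h => by simp [detourPlay, h]
  have hvisit : ∀ m k, detourPlay k = m + 3 → ∃ j ≥ k, detourPlay j = 2 := by
    intro m
    induction m with
    | zero =>
      intro k hk
      exact ⟨k + 2, by omega, h1 _ (by simp [detourPlay, hk])⟩
    | succ m ih =>
      intro k hk
      obtain ⟨j, hj, hj2⟩ := ih (k + 1) (by simp [detourPlay, hk])
      exact ⟨j, by omega, hj2⟩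
  obtain ⟨k, hk, hk2⟩ : ∃ j ≥ N, detourPlay j = 2 := by
    match hm : detourPlay N with
    | 0 => exact ⟨N + 2, by omega, h1 _ (by simp [detourPlay, hm])⟩
    | 1 => exact ⟨N + 1, by omega, h1 _ hm⟩
    | 2 => exact ⟨N, le_rfl, hm⟩
    | m + 3 => exact hvisit m N hm
  have hdown : ∀ i ≤ k, detourPlay (k + 1 + i) = k - i + 4 := by
    intro i
    induction i with
    | zero => intro _; simp [detourPlay, hk2]
    | succ i ih =>
      intro hi
      have h := ih (by omega)
      rw [show k + 1 + (i + 1) = k + 1 + i + 1 by omega, detourPlay, h]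
      simp only
      omega
  obtain ⟨j, hj, he, -⟩ := hN (k + 1)
  rw [hdown j (by omega)] at he
  simp [detourColor] at he

/-- With one memory state the move at `1` is constant. Staying never answers the request at `0`,
since color `2` is too large; leaving permits `detourPlay`. -/
theorem not_exists_isPositional_detour : ¬ ∃ σ : EveStrategy detourArena,
    IsPositional σ ∧ WinsFrom σ (BndParity detourColor) {0} := by
  rintro ⟨σ, ⟨𝓜, ν, hν⟩, hσ⟩
  rw [winsFrom_iff] at hσ
  replace hσ := hσ 0 rfl
  have hnext : ∀ w, σ.next w 1 = ν 1 0 := fun w => by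
    rw [hν w 1 rfl, Subsingleton.elim (𝓜.run 𝓜.init (w ++ [1])) 0]
  have hlegal : ν 1 0 = 1 ∨ ν 1 0 = 2 := by
    have h := σ.legal [] 1 rfl
    rw [hnext] at h
    dsimp only [detourArena] at h
    omega
  rcases hlegal with h | h
  · have hc : Consistent σ 0 fun k => if k = 0 then 0 else 1 := by
      refine ⟨rfl, fun k => ?_⟩
      rcases Nat.eq_zero_or_pos k with rfl | hk
      · exact ⟨by simp [detourArena], fun he => by simp [detourArena] at he⟩
      · exact ⟨by simp [detourArena, hk.ne'], fun _ => by simp [hk.ne', hnext, h]⟩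
    obtain ⟨N, hN⟩ := mem_bndParity_iff.1 (hσ _ hc)
    obtain ⟨j, -, he, hle⟩ := hN 0
    rcases Nat.eq_zero_or_pos j with rfl | hj
    · simp [detourColor] at he
    · simp [detourColor, hj.ne'] at hle
  · refine detourPlay_not_mem (hσ _ ⟨rfl, fun k => ?_⟩)
    rw [detourPlay]
    match detourPlay k with
    | 0 => exact ⟨by simp [detourArena], fun he => by simp [detourArena] at he⟩
    | 1 => exact ⟨by simp [detourArena], fun _ => by simp [hnext, h]⟩
    | 2 => exact ⟨by simp [detourArena], fun he => by simp [detourArena] at he⟩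
    | 3 => exact ⟨by simp [detourArena], fun he => by simp [detourArena] at he⟩
    | m + 4 => exact ⟨by simp [detourArena], fun he => by simp [detourArena] at he⟩

end BoundedParityGames

theorem mainTheorem6 :
    (∀ (V : Type*) [Countable V] (A : BoundedParityGames.Arena V) (d : ℕ) (c : V → Fin (d + 1)),
      ∃ σ : BoundedParityGames.EveStrategy A,
        BoundedParityGames.UsesMemoryStates σ (BoundedParityGames.numOddColors d + 1) ∧
        BoundedParityGames.WinsFrom σ (BoundedParityGames.BndParity c)
          (BoundedParityGames.winningSet A (BoundedParityGames.BndParity c))) ∧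
    (∃ (V : Type) (_ : Countable V) (A : BoundedParityGames.Arena V) (d : ℕ)
        (c : V → Fin (d + 1)),
      ∃ v₀ ∈ BoundedParityGames.winningSet A (BoundedParityGames.BndParity c),
        ¬ ∃ σ : BoundedParityGames.EveStrategy A,
          BoundedParityGames.IsPositional σ ∧
          BoundedParityGames.WinsFrom σ (BoundedParityGames.BndParity c) {v₀}) := by
  exact ⟨fun V _ A d c => BoundedParityGames.exists_memory_winsFrom_winningSet A c,
    ℕ, inferInstance, BoundedParityGames.detourArena, 2, BoundedParityGames.detourColor, 0,
    BoundedParityGames.zero_mem_winningSet_detour,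
    BoundedParityGames.not_exists_isPositional_detour⟩
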